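/- **Setting.** Let $\mathcal V$ be a finite vocabulary, $K\in\mathbb N$ a context bound, and $\mathcal V^{\le K}=\bigcup_{k=1}^{K}\mathcal V^k$ the set of prompts. Consider a causal decoder-only Transformer language model with embedding width $d\ge 4$ and $L\ge 1$ blocks. Its parameters $\theta\in\mathbb R^p$ are all the matrices and vectors named below, with no sharing. * For a prompt $s$ of length $n$, the embedding $X\in\mathbb R^{n\times d}$ has rows $\mathbf E_{s_i}+\mathbf P_i$, with $\mathbf E\in\mathbb R^{|\mathcal V|\times d}$ and $\mathbf P\in\mathbb R^{K\times d}$. * Layer normalization is $\mathrm{LN}(x)=\gamma\odot (x-\mu_x\mathbf 1)/\sqrt{\sigma_x^2+\varepsilon}+\beta$, where $\mu_x$ and $\sigma_x^2$ are the mean and variance of the coordinates of $x$, $\varepsilon>0$ is fixed, and each occurrence has its own $\gamma,\beta\in\mathbb R^d$. * Each block maps $X$ to $H+\mathrm{mlp}(\mathrm{LN}(H))$ with $H=X+\mathrm{attn}(\mathrm{LN}(X))$, where LN and mlp act row-wise. * $\mathrm{attn}(X)=[\eta_1(X),\dots,\eta_h(X)]\,W^O$ has $h\ge 1$ causal heads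 of dimension $d_\eta\ge 1$. Here $\eta_i(X)=A_i X V_i$, and $A_i$ is obtained from $(XQ_i)(XK_i)^\top/\sqrt{d_\eta}$ by a row-wise softmax restricted in row $a$ to the columns $b\le a$. The numbers $h$ and $d_\eta$ may depend on the block. * mlp is a multi-layer perceptron of any depth at least $1$ and any hidden widths (possibly different in each block), with weights, biases and a real-analytic activation $\mathbb R\to\mathbb R$. Let $\mathbf r(s;\theta)\in\mathbb R^d$ be the last row of the output of the last block, and let $f(s;\theta)=\mathrm{softmax}\big(U\,\mathrm{LN}(\mathbf r(s;\theta))\big)$ with $U\in\mathbb R^{|\mathcal V|\times d}$. A sample is a pair $z=(s,q)$ of a prompt $s$ and a probability vector $q$ on $\mathcal V$. Its loss is the cross-entropy $\mathcal L_z(\theta)=-\sum_{v}q_v\log f(s;\theta)_v$. A batch $\mathcal B$ is a nonempty finite multiset of samples, with loss $\mathcal L_{\mathcal B}=\frac1{|\mathcal B|}\sum_{z\in\mathcal B}\mathcal L_z$. **Corollary (SGD and mini-batch GD).** Fix a finite or countable set $\mathcal D$ of samples (the training data), a horizon $T\in\mathbb N_0$, and step sizes $\eta_0,\dots,\eta_{T-1}\in(0,1)$.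 Let $\theta_0$ be a random vector in $\mathbb R^p$ whose law is absolutely continuous with respect to Lebesgue measure, and let $$\theta_{t+1}=\theta_t-\eta_t\nabla\mathcal L_{\mathcal B_t}(\theta_t),\qquad 0\le t<T,$$ where the batches $\mathcal B_t$ are drawn from $\mathcal D$ in an arbitrary way: they may be random, and they may depend in any manner on $\theta_0,\dots,\theta_t$ (an adversarial choice). Then, with probability one, $$s\ne s'\ \Longrightarrow\ \mathbf r(s;\theta_T)\ne\mathbf r(s';\theta_T)\qquad\text{for all } s,s'\in\mathcal V^{\le K}.$$ In particular this covers single-sample SGD ($|\mathcal B_t|=1$) and, for finite $\mathcal D$, full-batch GD ($\mathcal B_t=\mathcal D$). -/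

import Mathlib

open MeasureTheory

/-- Shape of one pre-LN Transformer block: the number of attention heads, the attention
dimension `d_η`, and the list of hidden widths `[d₁, …, d_{M-1}]` of its MLP, which therefore has
`M = mlpHidden.length + 1` layers. -/
structure BlockShape where
  heads : ℕ
  attnDim : ℕ
  mlpHidden : List ℕ

/-- Architecture of a decoder-only Transformer language model: context bound `K`, embedding
width `d`, the number `L` of blocks with the shape of each block, the constant `ε` of
LayerNorm and the activation function of the MLPs. -/
structure TransformerArch where
  contextLen : ℕ
  width : ℕ
  depth : ℕ
  block : Fin depth → BlockShape
  lnEps : ℝ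
  act : ℝ → ℝ

/-- Coordinates of an affine map `ℝᵐ → ℝⁿ`: the entries of a weight matrix (on the left) and of a
bias (on the right). -/
abbrev AffineIdx (m n : ℕ) : Type := (Fin n × Fin m) ⊕ Fin n

/-- Coordinates of the parameters of an MLP `ℝᵐ → ℝⁿ` with the given hidden widths. -/
def MLPIdx : ℕ → List ℕ → ℕ → Type
  | m, [], n => AffineIdx m n
  | m, k :: ks, n => AffineIdx m k ⊕ MLPIdx k ks n

instance MLPIdx.instFintype : (m : ℕ) → (ks : List ℕ) → (n : ℕ) → Fintype (MLPIdx m ks n)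
  | m, [], n => inferInstanceAs (Fintype (AffineIdx m n))
  | m, k :: ks, n =>
    letI := MLPIdx.instFintype k ks n
    inferInstanceAs (Fintype (AffineIdx m k ⊕ MLPIdx k ks n))

/-- Coordinates of the parameters of one block: query, key and value matrices of each head, output
projection `W^O` (whose rows are indexed by a head and a coordinate of that head), scale and shift
of the two layer normalizations, and the MLP. -/
inductive BlockIdx (d : ℕ) (S : BlockShape) : Type
  | query (h : Fin S.heads) (i : Fin d) (j : Fin S.attnDim)
  | key (h : Fin S.heads) (i : Fin d) (j : Fin S.attnDim)
  | value (h : Fin S.heads) (i : Fin d) (j : Fin S.attnDim)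
  | out (h : Fin S.heads) (j : Fin S.attnDim) (i : Fin d)
  | attnScale (i : Fin d)
  | attnShift (i : Fin d)
  | mlpScale (i : Fin d)
  | mlpShift (i : Fin d)
  | mlp (a : MLPIdx d S.mlpHidden d)
  deriving Fintype

/-- Coordinates of all parameters of the model: token embeddings, positional embeddings, blocks,
and the scale, shift and matrix `U` of the unembedding layer. -/
inductive ParamIdx (V : Type*) (A : TransformerArch)
  | tok (v : V) (i : Fin A.width)
  | pos (k : Fin A.contextLen) (i : Fin A.width)
  | block (l : Fin A.depth) (j : BlockIdx A.width (A.block l))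
  | finalScale (i : Fin A.width)
  | finalShift (i : Fin A.width)
  | unembed (v : V) (i : Fin A.width)
  deriving Fintype

/-- The parameter space `ℝᵖ`, with its Euclidean structure and Lebesgue measure. -/
abbrev Params (V : Type*) [Fintype V] (A : TransformerArch) : Type _ :=
  EuclideanSpace ℝ (ParamIdx V A)

/-- The set `V^{≤ K}` of nonempty sequences of length at most `K`: a pair `⟨k, s⟩` with `k < K` is
a sequence `s` of length `k + 1`. -/
abbrev Prompt (V : Type*) (K : ℕ) : Type _ := Σ k : Fin K, (Fin (k.val + 1) → V)

/-- A training sample: a prompt with a target distribution on the vocabulary. -/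
abbrev Sample (V : Type*) [Fintype V] (K : ℕ) : Type _ := Prompt V K × stdSimplex ℝ V

noncomputable section

/-- The affine map `x ↦ W x + b`. -/
def affineMap {m n : ℕ} (w : AffineIdx m n → ℝ) (x : Fin m → ℝ) : Fin n → ℝ :=
  fun i => ∑ j, w (Sum.inl (i, j)) * x j + w (Sum.inr i)

/-- The MLP: affine layers with the activation `σ` applied entrywise between consecutive layers. -/
def mlpMap (σ : ℝ → ℝ) : (m : ℕ) → (ks : List ℕ) → (n : ℕ) →
    (MLPIdx m ks n → ℝ) → (Fin m → ℝ) → (Fin n → ℝ)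
  | _, [], _, w, x => affineMap w x
  | _, k :: ks, n, w, x =>
    mlpMap σ k ks n (fun a => w (Sum.inr a))
      (fun i => σ (affineMap (fun a => w (Sum.inl a)) x i))

/-- The mean of the coordinates of a vector. -/
def vecMean {d : ℕ} (x : Fin d → ℝ) : ℝ := (∑ i, x i) / d

/-- The variance of the coordinates of a vector. -/
def vecVar {d : ℕ} (x : Fin d → ℝ) : ℝ := (∑ i, (x i - vecMean x) ^ 2) / d

/-- Layer normalization with scale `γ`, shift `β` and constant `ε`. -/
def layerNorm {d : ℕ} (ε : ℝ) (γ β x : Fin d → ℝ) : Fin d → ℝ :=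
  fun i => γ i * ((x i - vecMean x) / Real.sqrt (vecVar x + ε)) + β i

/-- Causal attention weights of a matrix of logits: row-wise softmax restricted to `j ≤ i`. -/
def causalSoftmax {T : ℕ} (Z : Matrix (Fin T) (Fin T) ℝ) : Matrix (Fin T) (Fin T) ℝ :=
  Matrix.of fun i j => (if j ≤ i then Real.exp (Z i j) else 0) /
    ∑ k, (if k ≤ i then Real.exp (Z i k) else 0)

/-- One causal self-attention head. -/
def causalAttention {T d e : ℕ} (Q K W : Matrix (Fin d) (Fin e) ℝ)
    (X : Matrix (Fin T) (Fin d) ℝ) : Matrix (Fin T) (Fin e) ℝ :=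
  causalSoftmax ((Real.sqrt e)⁻¹ • ((X * Q) * (X * K).transpose)) * (X * W)

/-- Causal multi-head self-attention. Multiplying the concatenation of the heads by `W^O` amounts
to summing the products of the heads with the corresponding row blocks of `W^O`. -/
def multiHead {T d : ℕ} {S : BlockShape} (w : BlockIdx d S → ℝ)
    (X : Matrix (Fin T) (Fin d) ℝ) : Matrix (Fin T) (Fin d) ℝ :=
  ∑ h : Fin S.heads,
    causalAttention (Matrix.of fun i j => w (.query h i j))
      (Matrix.of fun i j => w (.key h i j)) (Matrix.of fun i j => w (.value h i j)) X * Matrix.of (fun j i => w (.out h j i))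

/-- The pre-LN Transformer block, with residual connections around attention and MLP. -/
def transformerBlock {T d : ℕ} {S : BlockShape} (ε : ℝ) (σ : ℝ → ℝ) (w : BlockIdx d S → ℝ)
    (X : Matrix (Fin T) (Fin d) ℝ) : Matrix (Fin T) (Fin d) ℝ :=
  let H : Matrix (Fin T) (Fin d) ℝ :=
    X + multiHead w
      (Matrix.of fun t =>
        layerNorm ε (fun i => w (.attnScale i)) (fun i => w (.attnShift i)) (X t))
  H + Matrix.of fun t => mlpMap σ d S.mlpHidden d (fun a => w (.mlp a))
    (layerNorm ε (fun i => w (.mlpScale i)) (fun i => w (.mlpShift i)) (H t))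

/-- The softmax of a vector of logits. -/
def softmaxVec {V : Type*} [Fintype V] (z : V → ℝ) : V → ℝ :=
  fun v => Real.exp (z v) / ∑ u, Real.exp (z u)

variable {V : Type*} [Fintype V] (A : TransformerArch)

/-- The embedding of a prompt: token embedding plus positional embedding. -/
def embed (θ : Params V A) (s : Prompt V A.contextLen) :
    Matrix (Fin (s.1.val + 1)) (Fin A.width) ℝ :=
  Matrix.of fun t i => θ (.tok (s.2 t) i) + θ (.pos ⟨t.val, by omega⟩ i)

/-- The output of the last block: block `0` is applied first, block `L - 1` last. -/
def hiddenStates (θ : Params V A) (s : Prompt V A.contextLen) :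
    Matrix (Fin (s.1.val + 1)) (Fin A.width) ℝ :=
  (List.finRange A.depth).foldl
    (fun X l => transformerBlock A.lnEps A.act (fun j => θ (.block l j)) X) (embed A θ s)

/-- The last-token representation `r(s ; θ)`. -/
def lastToken (θ : Params V A) (s : Prompt V A.contextLen) : Fin A.width → ℝ :=
  hiddenStates A θ s (Fin.last s.1.val)

/-- The next-token prediction `f(s ; θ) = softmax (U LN(r(s ; θ)))`. -/
def nextToken (θ : Params V A) (s : Prompt V A.contextLen) : V → ℝ :=
  softmaxVec fun v => ∑ i, θ (.unembed v i) *
    layerNorm A.lnEps (fun i => θ (.finalScale i)) (fun i => θ (.finalShift i))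
      (lastToken A θ s) i

/-- The cross-entropy loss of one sample. -/
def sampleLoss (z : Sample V A.contextLen) (θ : Params V A) : ℝ :=
  -∑ v, (z.2 : V → ℝ) v * Real.log (nextToken A θ z.1 v)

/-- The loss of a batch (a finite multiset of samples): the average of the sample losses. -/
def batchLoss (B : Multiset (Sample V A.contextLen)) (θ : Params V A) : ℝ :=
  (B.map fun z => sampleLoss A z θ).sum / (B.card : ℝ)

end

/-! ### Null sets and real-analytic maps -/

section AnalyticGeneral

open Set Topology Filter

theorem volume_zeros_eq_zero_of_analytic_real {g : ℝ → ℝ} (hg : AnalyticOnNhd ℝ g univ)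
    {x₀ : ℝ} (h₀ : g x₀ ≠ 0) : volume {t | g t = 0} = 0 := by
  refine measure_null_of_locally_null _ fun x _ => ?_
  rcases (hg x (mem_univ x)).eventually_eq_zero_or_eventually_ne_zero with h | h
  · exact absurd (hg.eqOn_zero_of_preconnected_of_eventuallyEq_zero isPreconnected_univ
      (mem_univ x) h (mem_univ x₀)) h₀
  · refine ⟨{t | g t = 0} ∩ {t | t ≠ x → g t ≠ 0},
      inter_mem_nhdsWithin _ (eventually_nhdsWithin_iff.1 h), ?_⟩
    refine measure_mono_null (t := {x}) ?_ (measure_singleton x)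
    rintro t ⟨h1, h2⟩
    by_contra hne
    exact h2 hne h1

variable {E : Type*} [NormedAddCommGroup E] [InnerProductSpace ℝ E] [FiniteDimensional ℝ E]

theorem analyticOnNhd_det_fderiv {φ : E → E} (hφ : AnalyticOnNhd ℝ φ univ) :
    AnalyticOnNhd ℝ (fun x => (fderiv ℝ φ x).det) univ := by
  intro x hx
  set b := stdOrthonormalBasis ℝ E
  have hentry : ∀ i j, AnalyticAt ℝ (fun x => LinearMap.toMatrix b.toBasis b.toBasis
      (fderiv ℝ φ x : E →ₗ[ℝ] E) i j) x := by
    intro i j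
    have h1 : AnalyticAt ℝ (fun x => fderiv ℝ φ x (b j)) x :=
      ((ContinuousLinearMap.apply ℝ E (b j)).analyticAt _).fun_comp (hφ.fderiv x hx)
    have h2 : AnalyticAt ℝ (fun x => inner ℝ (b i) (fderiv ℝ φ x (b j))) x :=
      ((innerSL ℝ (b i)).analyticAt _).fun_comp h1
    refine h2.congr (Eventually.of_forall fun y => ?_)
    simp [LinearMap.toMatrix_apply, OrthonormalBasis.repr_apply_apply]
  have hdet : AnalyticAt ℝ (fun x => (LinearMap.toMatrix b.toBasis b.toBasis
      (fderiv ℝ φ x : E →ₗ[ℝ] E)).det) x := by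
    simp only [Matrix.det_apply']
    refine Finset.analyticAt_fun_sum _ fun σ _ => ?_
    exact analyticAt_const.mul (Finset.analyticAt_fun_prod _ fun i _ => hentry _ _)
  refine hdet.congr (Eventually.of_forall fun y => ?_)
  simp only [LinearMap.det_toMatrix]

variable [MeasurableSpace E] [BorelSpace E] (μ : Measure E) [μ.IsAddHaarMeasure]

/-- In polar coordinates, the restriction of `f` to each ray is analytic in one variable and nonzero
at `t = 0`, so its zeros are null; Fubini then applies. -/
theorem addHaar_zeros_eq_zero_of_analytic_of_zero {f : E → ℝ} (hf : AnalyticOnNhd ℝ f univ)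
    (h₀ : f 0 ≠ 0) : μ {x | f x = 0} = 0 := by
  have hfc : Continuous f := continuous_iff_continuousAt.2 fun x => (hf x (mem_univ x)).continuousAt
  have hZ : MeasurableSet {x | f x = 0} := (isClosed_eq hfc continuous_const).measurableSet
  set S : Set ({0}ᶜ : Set E) := Subtype.val ⁻¹' {x | f x = 0} with hS
  have hSm : MeasurableSet S := measurable_subtype_coe hZ
  have h1 : μ {x | f x = 0} = μ.comap (Subtype.val : ({0}ᶜ : Set E) → E) S := by
    rw [comap_subtype_coe_apply (measurableSet_singleton _).compl, hS,
      Subtype.image_preimage_coe]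
    congr 1
    ext x
    simp only [mem_ofPred_eq, mem_inter_iff, mem_compl_iff, mem_singleton_iff]
    refine ⟨fun h => ⟨?_, h⟩, fun h => h.2⟩
    rintro rfl
    exact h₀ h
  set e := homeomorphUnitSphereProd E
  have h2 : S = e ⁻¹' (e.symm ⁻¹' S) := by
    ext x; simp
  have hm : MeasurableSet (e.symm ⁻¹' S) := e.symm.measurable hSm
  rw [h1, h2, (μ.measurePreserving_homeomorphUnitSphereProd).measure_preimage hm.nullMeasurableSet,
    Measure.measure_prod_null hm]
  refine Eventually.of_forall fun y => ?_
  -- The radial measure has a density with respect to Lebesgue measure, so one-dimensional nullity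
  -- suffices.
  have hac : Measure.volumeIoiPow (Module.finrank ℝ E - 1) ≪
      Measure.comap (Subtype.val : Ioi (0 : ℝ) → ℝ) volume := withDensity_absolutelyContinuous _ _
  refine hac ?_
  rw [comap_subtype_coe_apply measurableSet_Ioi]
  have hline : AnalyticOnNhd ℝ (fun t : ℝ => f (t • (y : E))) univ := fun t _ =>
    (hf _ (mem_univ _)).fun_comp (g := f) (f := fun t : ℝ => t • (y : E)) (by fun_prop)
  refine measure_mono_null ?_
    (volume_zeros_eq_zero_of_analytic_real hline (x₀ := 0) (by simpa using h₀))
  rintro _ ⟨r, hr, rfl⟩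
  simpa [hS, e] using hr

/-- The zero set of a real-analytic function that does not vanish identically is null. -/
theorem addHaar_zeros_eq_zero_of_analytic {f : E → ℝ} (hf : AnalyticOnNhd ℝ f univ)
    {x₀ : E} (h₀ : f x₀ ≠ 0) : μ {x | f x = 0} = 0 := by
  have h := addHaar_zeros_eq_zero_of_analytic_of_zero μ (f := fun x => f (x + x₀))
    (fun x _ => (hf _ (mem_univ _)).fun_comp (g := f) (f := fun x => x + x₀) (by fun_prop))
    (by simpa using h₀)
  have h' := measure_preimage_add_right μ x₀ {x | f x = 0}
  rw [← h']
  exact h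

/-- Preimages of null sets under an analytic self-map with somewhere invertible derivative are
null. -/
theorem addHaar_preimage_eq_zero_of_analytic {φ : E → E} (hφ : AnalyticOnNhd ℝ φ univ) {x₀ : E}
    (hinj : Function.Injective (fderiv ℝ φ x₀)) {N : Set E} (hN : μ N = 0) :
    μ (φ ⁻¹' N) = 0 := by
  have hdet₀ : (fderiv ℝ φ x₀).det ≠ 0 := by
    have hunit : IsUnit (fderiv ℝ φ x₀ : E →ₗ[ℝ] E) :=
      (LinearMap.isUnit_iff_ker_eq_bot _).2 (LinearMap.ker_eq_bot.2 hinj)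
    exact (LinearMap.isUnit_det _ hunit).ne_zero
  have hnull : μ {x | (fderiv ℝ φ x).det = 0} = 0 :=
    addHaar_zeros_eq_zero_of_analytic μ (analyticOnNhd_det_fderiv hφ) hdet₀
  -- Critical points are already null. Near any other point, `φ` expands measure by a factor at
  -- least some `m > 0`, so a piece of the preimage is null as soon as its image is.
  suffices h : μ (φ ⁻¹' N \ {x | (fderiv ℝ φ x).det = 0}) = 0 by
    exact measure_mono_null (fun x hx => by
      by_cases hd : (fderiv ℝ φ x).det = 0
      · exact Or.inr hd
      · exact Or.inl ⟨hx, hd⟩) (measure_union_null h hnull)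
  refine measure_null_of_locally_null _ fun x hx => ?_
  have hd : (0 : ENNReal) < ENNReal.ofReal |(fderiv ℝ φ x).det| := by
    simpa using hx.2
  obtain ⟨m, hm0, hm⟩ := ENNReal.lt_iff_exists_nnreal_btwn.1 hd
  obtain ⟨δ, hδ, hδ0⟩ := ((mul_le_addHaar_image_of_lt_det μ _ hm).and
    self_mem_nhdsWithin).exists
  obtain ⟨s, hs, happ⟩ := (hφ x (mem_univ x)).hasStrictFDerivAt.approximates_deriv_on_nhds
    (Or.inr (show 0 < δ from hδ0))
  refine ⟨s ∩ φ ⁻¹' N, inter_mem (mem_nhdsWithin_of_mem_nhds hs)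
    (mem_of_superset self_mem_nhdsWithin fun y hy => hy.1), ?_⟩
  have hle := hδ _ φ (happ.mono_set inter_subset_left : ApproximatesLinearOn φ _ (s ∩ φ ⁻¹' N) δ)
  have h0 : μ (φ '' (s ∩ φ ⁻¹' N)) = 0 :=
    measure_mono_null (by rintro _ ⟨y, hy, rfl⟩; exact hy.2) hN
  rw [h0] at hle
  exact (mul_eq_zero.1 (le_antisymm hle zero_le)).resolve_left (by exact_mod_cast hm0.ne')

end AnalyticGeneral

/-! ### Gradient steps and their derivative at the origin -/

section GradientStep

open Set Topology Filter

variable {E : Type*} [NormedAddCommGroup E] [InnerProductSpace ℝ E] [FiniteDimensional ℝ E]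

theorem analyticOnNhd_gradient {f : E → ℝ} (hf : AnalyticOnNhd ℝ f univ) :
    AnalyticOnNhd ℝ (gradient f) univ := by
  intro x hx
  set b := stdOrthonormalBasis ℝ E
  have h : AnalyticAt ℝ (fun x => ∑ i, fderiv ℝ f x (b i) • b i) x := by
    refine Finset.analyticAt_fun_sum _ fun i _ => ?_
    exact (((ContinuousLinearMap.apply ℝ ℝ (b i)).analyticAt _).fun_comp
      (hf.fderiv x hx)).smul analyticAt_const
  refine h.congr (Eventually.of_forall fun y => ?_)
  simp only
  rw [← b.sum_repr' (gradient f y)]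
  refine Finset.sum_congr rfl fun i _ => ?_
  rw [real_inner_comm, inner_gradient_left]

/-- A gradient step has injective derivative at a point where the second directional derivatives
are bounded by the squared norm. -/
theorem fderiv_gradientStep_injective {f : E → ℝ} (hf : AnalyticOnNhd ℝ f univ) {η : ℝ}
    (hη₀ : 0 < η) (hη₁ : η < 1)
    (hray : ∀ v : E, ∃ k : ℝ → ℝ, ContinuousAt k 0 ∧
      (∀ t, HasDerivAt (fun t : ℝ => f (t • v)) (t * k t) t) ∧ k 0 ≤ ‖v‖ ^ 2) :
    Function.Injective (fderiv ℝ (fun x => x - η • gradient f x) 0) := by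
  have hg := analyticOnNhd_gradient hf
  have hgd : DifferentiableAt ℝ (gradient f) 0 := (hg 0 (mem_univ 0)).differentiableAt
  have hfd : ∀ x, DifferentiableAt ℝ f x := fun x => (hf x (mem_univ x)).differentiableAt
  have hφ : HasFDerivAt (fun x => x - η • gradient f x)
      (ContinuousLinearMap.id ℝ E - η • fderiv ℝ (gradient f) 0) 0 :=
    (hasFDerivAt_id 0).sub (hgd.hasFDerivAt.const_smul η)
  rw [hφ.fderiv]
  refine (injective_iff_map_eq_zero _).2 fun v hv => ?_
  obtain ⟨k, hk, hderiv, hk0⟩ := hray v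
  have hline : ∀ t : ℝ, HasDerivAt (fun t : ℝ => t • v) v t := fun t => by
    simpa using (hasDerivAt_id t).smul_const v
  have hgrad : ∀ t : ℝ, inner ℝ (gradient f (t • v)) v = t * k t := fun t => by
    rw [inner_gradient_left]
    exact (((hfd (t • v)).hasFDerivAt.comp_hasDerivAt t (hline t)).unique (hderiv t))
  have h1 : HasDerivAt (fun t : ℝ => inner ℝ (gradient f (t • v)) v)
      (inner ℝ (fderiv ℝ (gradient f) 0 v) v) 0 := by
    have h := hgd.hasFDerivAt
    rw [← zero_smul ℝ v] at h
    have h' := h.comp_hasDerivAt 0 (hline 0)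
    simpa using h'.inner ℝ (hasDerivAt_const (0 : ℝ) v)
  -- Continuity of `k` at `0` is enough: the difference quotient at `0` is `k` itself.
  have h2 : HasDerivAt (fun t : ℝ => t * k t) (k 0) 0 := by
    rw [hasDerivAt_iff_tendsto_slope]
    refine (hk.tendsto.mono_left nhdsWithin_le_nhds).congr' ?_
    filter_upwards [self_mem_nhdsWithin] with t (ht : t ≠ 0)
    simp [slope, ht]
  have heq : inner ℝ (fderiv ℝ (gradient f) 0 v) v = k 0 := by
    refine HasDerivAt.unique h1 ?_
    simpa only [hgrad] using h2
  have hv' : v = η • fderiv ℝ (gradient f) 0 v := by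
    simpa [sub_eq_zero] using hv
  have h3 : ‖v‖ ^ 2 = η * k 0 := by
    rw [← heq, ← real_inner_self_eq_norm_sq, ← real_inner_smul_left, ← hv']
  have h4 : ‖v‖ ^ 2 ≤ 0 := by nlinarith [sq_nonneg ‖v‖]
  exact norm_eq_zero.1 (pow_eq_zero_iff two_ne_zero |>.1 (le_antisymm h4 (sq_nonneg _)))

end GradientStep

theorem Prompt.nonempty_vocab {V : Type*} {K : ℕ} (s : Prompt V K) : Nonempty V := ⟨s.2 0⟩

/-! ### Analyticity of the network layers -/

section AnalyticNetwork

variable {E : Type*} [NormedAddCommGroup E] [NormedSpace ℝ E] {e₀ : E}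

theorem AnalyticAt.real_sqrt {f : E → ℝ} (hf : AnalyticAt ℝ f e₀) (h : f e₀ ≠ 0) :
    AnalyticAt ℝ (fun e => Real.sqrt (f e)) e₀ :=
  AnalyticAt.fun_comp (g := Real.sqrt)
    ((Real.contDiffAt_sqrt h : ContDiffAt ℝ ⊤ _ _).analyticAt) hf

theorem AnalyticAt.real_log {f : E → ℝ} (hf : AnalyticAt ℝ f e₀) (h : 0 < f e₀) :
    AnalyticAt ℝ (fun e => Real.log (f e)) e₀ :=
  AnalyticAt.fun_comp (g := Real.log) (_root_.analyticAt_log h) hf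

theorem analyticAt_affineMap {m n : ℕ} {w : E → AffineIdx m n → ℝ} {x : E → Fin m → ℝ}
    (hw : ∀ a, AnalyticAt ℝ (fun e => w e a) e₀) (hx : ∀ i, AnalyticAt ℝ (fun e => x e i) e₀)
    (i : Fin n) : AnalyticAt ℝ (fun e => affineMap (w e) (x e) i) e₀ :=
  (Finset.analyticAt_fun_sum _ fun j _ => (hw _).mul (hx j)).add (hw _)

theorem analyticAt_mlpMap {σ : ℝ → ℝ} (hσ : AnalyticOnNhd ℝ σ Set.univ) :
    ∀ (ks : List ℕ) (m n : ℕ) {w : E → MLPIdx m ks n → ℝ} {x : E → Fin m → ℝ},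
      (∀ a, AnalyticAt ℝ (fun e => w e a) e₀) → (∀ i, AnalyticAt ℝ (fun e => x e i) e₀) →
      ∀ i, AnalyticAt ℝ (fun e => mlpMap σ m ks n (w e) (x e) i) e₀
  | [], _, _, _, _, hw, hx, i => analyticAt_affineMap hw hx i
  | k :: ks, _, n, _, _, hw, hx, i =>
    analyticAt_mlpMap hσ ks k n (fun a => hw (Sum.inr a))
      (fun i => (hσ _ (Set.mem_univ _)).fun_comp
        (analyticAt_affineMap (fun a => hw (Sum.inl a)) hx i)) i

theorem vecVar_nonneg {d : ℕ} (x : Fin d → ℝ) : 0 ≤ vecVar x :=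
  div_nonneg (Finset.sum_nonneg fun _ _ => sq_nonneg _) (Nat.cast_nonneg d)

theorem analyticAt_vecMean {d : ℕ} {x : E → Fin d → ℝ}
    (hx : ∀ i, AnalyticAt ℝ (fun e => x e i) e₀) : AnalyticAt ℝ (fun e => vecMean (x e)) e₀ := by
  simp only [vecMean, div_eq_mul_inv]
  exact (Finset.analyticAt_fun_sum _ fun i _ => hx i).mul analyticAt_const

/-- The positive `ε` keeps the square root away from its singularity at `0`. -/
theorem analyticAt_layerNorm {d : ℕ} {ε : ℝ} (hε : 0 < ε) {γ β x : E → Fin d → ℝ}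
    (hγ : ∀ i, AnalyticAt ℝ (fun e => γ e i) e₀) (hβ : ∀ i, AnalyticAt ℝ (fun e => β e i) e₀)
    (hx : ∀ i, AnalyticAt ℝ (fun e => x e i) e₀) (i : Fin d) :
    AnalyticAt ℝ (fun e => layerNorm ε (γ e) (β e) (x e) i) e₀ := by
  have hvar : AnalyticAt ℝ (fun e => vecVar (x e)) e₀ := by
    simp only [vecVar, div_eq_mul_inv]
    exact (Finset.analyticAt_fun_sum _ fun i _ =>
      ((hx i).sub (analyticAt_vecMean hx)).pow 2).mul analyticAt_const
  have hpos : 0 < vecVar (x e₀) + ε := add_pos_of_nonneg_of_pos (vecVar_nonneg _) hε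
  exact ((hγ i).mul (((hx i).sub (analyticAt_vecMean hx)).div
    ((hvar.add analyticAt_const).real_sqrt hpos.ne') (Real.sqrt_pos.2 hpos).ne')).add (hβ i)

theorem analyticAt_matrixMul {l m n : Type*} [Fintype m] {M : E → Matrix l m ℝ}
    {N : E → Matrix m n ℝ} (hM : ∀ i j, AnalyticAt ℝ (fun e => M e i j) e₀)
    (hN : ∀ i j, AnalyticAt ℝ (fun e => N e i j) e₀) (i : l) (j : n) :
    AnalyticAt ℝ (fun e => (M e * N e) i j) e₀ := by
  simp only [Matrix.mul_apply]
  exact Finset.analyticAt_fun_sum _ fun k _ => (hM i k).mul (hN k j)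

theorem causalSoftmax_denom_pos {T : ℕ} (Z : Matrix (Fin T) (Fin T) ℝ) (i : Fin T) :
    0 < ∑ k, (if k ≤ i then Real.exp (Z i k) else 0) :=
  Finset.sum_pos' (fun k _ => by split_ifs <;> positivity)
    ⟨i, Finset.mem_univ i, by simp [Real.exp_pos]⟩

theorem analyticAt_causalSoftmax {T : ℕ} {Z : E → Matrix (Fin T) (Fin T) ℝ}
    (hZ : ∀ i j, AnalyticAt ℝ (fun e => Z e i j) e₀) (i j : Fin T) :
    AnalyticAt ℝ (fun e => causalSoftmax (Z e) i j) e₀ := by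
  -- The causal mask depends on indices only, so the case split is constant in the parameters.
  have h : ∀ k, AnalyticAt ℝ (fun e => if k ≤ i then Real.exp (Z e i k) else 0) e₀ := fun k => by
    split_ifs
    · exact (hZ i k).rexp'
    · exact analyticAt_const
  exact (h j).div (Finset.analyticAt_fun_sum _ fun k _ => h k) (causalSoftmax_denom_pos _ i).ne'

theorem analyticAt_causalAttention {T d m : ℕ} {Q K W : E → Matrix (Fin d) (Fin m) ℝ}
    {X : E → Matrix (Fin T) (Fin d) ℝ}
    (hQ : ∀ i j, AnalyticAt ℝ (fun e => Q e i j) e₀)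
    (hK : ∀ i j, AnalyticAt ℝ (fun e => K e i j) e₀)
    (hW : ∀ i j, AnalyticAt ℝ (fun e => W e i j) e₀)
    (hX : ∀ i j, AnalyticAt ℝ (fun e => X e i j) e₀) (i : Fin T) (j : Fin m) :
    AnalyticAt ℝ (fun e => causalAttention (Q e) (K e) (W e) (X e) i j) e₀ := by
  refine analyticAt_matrixMul (analyticAt_causalSoftmax fun i j => ?_)
    (analyticAt_matrixMul hX hW) i j
  exact analyticAt_const.mul (analyticAt_matrixMul (analyticAt_matrixMul hX hQ)
    (fun i j => analyticAt_matrixMul hX hK j i) i j)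

theorem analyticAt_transformerBlock {T d : ℕ} {S : BlockShape} {ε : ℝ} (hε : 0 < ε) {σ : ℝ → ℝ}
    (hσ : AnalyticOnNhd ℝ σ Set.univ) {w : E → BlockIdx d S → ℝ}
    {X : E → Matrix (Fin T) (Fin d) ℝ} (hw : ∀ a, AnalyticAt ℝ (fun e => w e a) e₀)
    (hX : ∀ i j, AnalyticAt ℝ (fun e => X e i j) e₀) (i : Fin T) (j : Fin d) :
    AnalyticAt ℝ (fun e => transformerBlock ε σ (w e) (X e) i j) e₀ := by
  have hH : ∀ i j, AnalyticAt ℝ (fun e => (X e + multiHead (w e)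
      (Matrix.of fun t => layerNorm ε (fun i => w e (.attnScale i)) (fun i => w e (.attnShift i))
        (X e t))) i j) e₀ := by
    intro i j
    simp only [multiHead, Matrix.add_apply, Matrix.sum_apply]
    refine (hX i j).add (Finset.analyticAt_fun_sum _ fun h _ => ?_)
    refine analyticAt_matrixMul (analyticAt_causalAttention (fun _ _ => hw _) (fun _ _ => hw _)
      (fun _ _ => hw _) fun t j => ?_) (fun _ _ => hw _) i j
    exact analyticAt_layerNorm hε (fun _ => hw _) (fun _ => hw _) (fun k => hX t k) j
  refine (hH i j).add (analyticAt_mlpMap hσ _ _ _ (fun _ => hw _) (fun k => ?_) j)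
  exact analyticAt_layerNorm hε (fun _ => hw _) (fun _ => hw _) (fun k => hH i k) k

theorem analyticAt_foldl_transformerBlock {T d L : ℕ} {S : Fin L → BlockShape} {ε : ℝ}
    (hε : 0 < ε) {σ : ℝ → ℝ} (hσ : AnalyticOnNhd ℝ σ Set.univ)
    {w : E → (l : Fin L) → BlockIdx d (S l) → ℝ} (hw : ∀ l a, AnalyticAt ℝ (fun e => w e l a) e₀) :
    ∀ (ls : List (Fin L)) {X : E → Matrix (Fin T) (Fin d) ℝ},
      (∀ i j, AnalyticAt ℝ (fun e => X e i j) e₀) → ∀ i j, AnalyticAt ℝ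
        (fun e => ls.foldl (fun X l => transformerBlock ε σ (w e l) X) (X e) i j) e₀
  | [], _, hX, i, j => hX i j
  | l :: ls, _, hX, i, j => analyticAt_foldl_transformerBlock hε hσ hw ls
      (analyticAt_transformerBlock hε hσ (hw l) hX) i j

end AnalyticNetwork

/-! ### Analyticity of representations and losses -/

section AnalyticModel

variable {V : Type*} [Fintype V] {A : TransformerArch}

theorem analyticAt_param (a : ParamIdx V A) (θ₀ : Params V A) :
    AnalyticAt ℝ (fun θ : Params V A => θ a) θ₀ :=
  (EuclideanSpace.proj (𝕜 := ℝ) a).analyticAt θ₀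

theorem analyticAt_lastToken (heps : 0 < A.lnEps) (hact : AnalyticOnNhd ℝ A.act Set.univ)
    (s : Prompt V A.contextLen) (i : Fin A.width) (θ₀ : Params V A) :
    AnalyticAt ℝ (fun θ => lastToken A θ s i) θ₀ := by
  unfold lastToken hiddenStates
  exact analyticAt_foldl_transformerBlock heps hact
    (w := fun (θ : Params V A) l j => θ (.block l j)) (fun _ _ => analyticAt_param _ _) _
    (fun t i => (analyticAt_param _ _).add (analyticAt_param _ _)) _ i

theorem exp_sum_pos [Nonempty V] (z : V → ℝ) : 0 < ∑ u, Real.exp (z u) :=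
  Finset.sum_pos (fun _ _ => Real.exp_pos _) Finset.univ_nonempty

theorem log_softmaxVec [Nonempty V] (z : V → ℝ) (v : V) :
    Real.log (softmaxVec z v) = z v - Real.log (∑ u, Real.exp (z u)) := by
  rw [softmaxVec, Real.log_div (Real.exp_pos _).ne' (exp_sum_pos z).ne', Real.log_exp]

/-- The logits of the next-token prediction. -/
noncomputable def logits (A : TransformerArch) (θ : Params V A) (s : Prompt V A.contextLen)
    (v : V) : ℝ :=
  ∑ i, θ (.unembed v i) * layerNorm A.lnEps (fun i => θ (.finalScale i))
    (fun i => θ (.finalShift i)) (lastToken A θ s) i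

/-- Since the target sums to one, the cross-entropy is log-sum-exp minus a linear form in the
logits. -/
theorem sampleLoss_eq (z : Sample V A.contextLen) (θ : Params V A) :
    sampleLoss A z θ = Real.log (∑ u, Real.exp (logits A θ z.1 u)) -
      ∑ v, (z.2 : V → ℝ) v * logits A θ z.1 v := by
  have := Prompt.nonempty_vocab z.1
  have h : ∀ v, Real.log (nextToken A θ z.1 v) =
      logits A θ z.1 v - Real.log (∑ u, Real.exp (logits A θ z.1 u)) := fun v =>
    log_softmaxVec (logits A θ z.1) v
  simp only [sampleLoss, h, mul_sub, Finset.sum_sub_distrib, ← Finset.sum_mul]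
  rw [show ∑ v, (z.2 : V → ℝ) v = 1 from z.2.2.2]
  ring

theorem analyticAt_logits (heps : 0 < A.lnEps) (hact : AnalyticOnNhd ℝ A.act Set.univ)
    (s : Prompt V A.contextLen) (v : V) (θ₀ : Params V A) :
    AnalyticAt ℝ (fun θ => logits A θ s v) θ₀ :=
  Finset.analyticAt_fun_sum _ fun i _ => (analyticAt_param _ _).mul
    (analyticAt_layerNorm heps (fun _ => analyticAt_param _ _) (fun _ => analyticAt_param _ _)
      (fun i => analyticAt_lastToken heps hact s i θ₀) i)

theorem analyticAt_sampleLoss (heps : 0 < A.lnEps) (hact : AnalyticOnNhd ℝ A.act Set.univ)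
    (z : Sample V A.contextLen) (θ₀ : Params V A) : AnalyticAt ℝ (sampleLoss A z) θ₀ := by
  have := Prompt.nonempty_vocab z.1
  have h := analyticAt_logits heps hact z.1 (θ₀ := θ₀)
  have hS : AnalyticAt ℝ (fun θ => ∑ u, Real.exp (logits A θ z.1 u)) θ₀ :=
    Finset.analyticAt_fun_sum _ fun u _ => (h u).rexp'
  have h1 : AnalyticAt ℝ (fun θ => Real.log (∑ u, Real.exp (logits A θ z.1 u)) -
      ∑ v, (z.2 : V → ℝ) v * logits A θ z.1 v) θ₀ :=
    (hS.real_log (exp_sum_pos _)).sub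
      (Finset.analyticAt_fun_sum _ fun v _ => analyticAt_const.mul (h v))
  exact h1.congr (Filter.Eventually.of_forall fun θ => (sampleLoss_eq z θ).symm)

theorem analyticAt_batchLoss (heps : 0 < A.lnEps) (hact : AnalyticOnNhd ℝ A.act Set.univ)
    (B : Multiset (Sample V A.contextLen)) (θ₀ : Params V A) :
    AnalyticAt ℝ (batchLoss A B) θ₀ := by
  have h : AnalyticAt ℝ (fun θ => (B.map fun z => sampleLoss A z θ).sum) θ₀ := by
    induction B using Multiset.induction_on with
    | empty => simpa using analyticAt_const
    | cons z B ih => simpa using (analyticAt_sampleLoss heps hact z θ₀).fun_add ih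
  unfold batchLoss
  simp only [div_eq_mul_inv]
  exact h.mul analyticAt_const

end AnalyticModel

/-! ### Parameters separating two given prompts -/

section Witness

theorem mlpMap_of_params_zero (σ : ℝ → ℝ) : ∀ (ks : List ℕ) (m n : ℕ) (w : MLPIdx m ks n → ℝ)
    (x : Fin m → ℝ), (∀ a, w a = 0) → mlpMap σ m ks n w x = 0
  | [], _, _, w, x, h => by
    funext i
    have h1 : ∀ j, w (Sum.inl (i, j)) = 0 := fun j => h _
    have h2 : w (Sum.inr i) = 0 := h _
    simp [mlpMap, affineMap, h1, h2]
  | _ :: ks, _, n, _, _, h => mlpMap_of_params_zero σ ks _ n _ _ fun _ => h _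

theorem transformerBlock_of_mlp_zero {T d : ℕ} {S : BlockShape} {ε : ℝ} {σ : ℝ → ℝ}
    {w : BlockIdx d S → ℝ} (hmlp : ∀ a, w (.mlp a) = 0) (X : Matrix (Fin T) (Fin d) ℝ) :
    transformerBlock ε σ w X = X + multiHead w (Matrix.of fun t =>
      layerNorm ε (fun i => w (.attnScale i)) (fun i => w (.attnShift i)) (X t)) := by
  ext t i
  simp [transformerBlock, mlpMap_of_params_zero σ _ _ _ _ _ hmlp]

theorem transformerBlock_of_out_mlp_zero {T d : ℕ} {S : BlockShape} {ε : ℝ} {σ : ℝ → ℝ}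
    {w : BlockIdx d S → ℝ} (hout : ∀ h j i, w (.out h j i) = 0) (hmlp : ∀ a, w (.mlp a) = 0)
    (X : Matrix (Fin T) (Fin d) ℝ) : transformerBlock ε σ w X = X := by
  rw [transformerBlock_of_mlp_zero hmlp]
  ext t i
  simp [multiHead, hout, Matrix.sum_apply, Matrix.mul_apply]

theorem List.foldl_of_forall_eq_self {α β : Type*} {f : α → β → α} (h : ∀ a b, f a b = a) :
    ∀ (l : List β) (a : α), l.foldl f a = a
  | [], _ => rfl
  | b :: l, a => by rw [List.foldl_cons, h, List.foldl_of_forall_eq_self h l]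

theorem List.foldl_finRange_of_pos_eq_self {α : Type*} {L : ℕ} (hL : 0 < L) {f : α → Fin L → α}
    (h : ∀ a l, l.val ≠ 0 → f a l = a) (a : α) : (List.finRange L).foldl f a = f a ⟨0, hL⟩ := by
  cases L with
  | zero => exact absurd hL (lt_irrefl 0)
  | succ n =>
    rw [List.finRange_succ, List.foldl_cons, List.foldl_map,
      List.foldl_of_forall_eq_self fun a (l : Fin n) => h a l.succ (Nat.succ_ne_zero _)]
    rfl

variable {V : Type*} [Fintype V] {A : TransformerArch}

theorem lastToken_of_block_zero {θ : Params V A} (hθ : ∀ l j, θ (.block l j) = 0)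
    (s : Prompt V A.contextLen) (i : Fin A.width) :
    lastToken A θ s i = θ (.tok (s.2 (Fin.last _)) i) + θ (.pos s.1 i) := by
  rw [lastToken, hiddenStates, List.foldl_of_forall_eq_self fun X l =>
    transformerBlock_of_out_mlp_zero (fun _ _ _ => hθ l _) (fun _ => hθ l _) X]
  rfl

theorem causalSoftmax_zero_last {n : ℕ} (j : Fin (n + 1)) :
    causalSoftmax (0 : Matrix (Fin (n + 1)) (Fin (n + 1)) ℝ) (Fin.last n) j = ((n : ℝ) + 1)⁻¹ := by
  simp [causalSoftmax, Fin.le_last]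

/-- Layer normalization of a multiple of the first basis vector, in the first coordinate. -/
noncomputable def lnFirst (d : ℕ) [NeZero d] (ε c : ℝ) : ℝ :=
  layerNorm ε 1 0 (Pi.single (0 : Fin d) c) 0

theorem lnFirst_eq {d : ℕ} [NeZero d] (ε c : ℝ) : lnFirst d ε c =
    c * (1 - (d : ℝ)⁻¹) / Real.sqrt (c ^ 2 * vecVar (Pi.single (0 : Fin d) (1 : ℝ)) + ε) := by
  have hm : ∀ c : ℝ, vecMean (Pi.single (0 : Fin d) c) = c * (d : ℝ)⁻¹ := fun c => by
    simp [vecMean, div_eq_mul_inv]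
  have hv : vecVar (Pi.single (0 : Fin d) c) =
      c ^ 2 * vecVar (Pi.single (0 : Fin d) (1 : ℝ)) := by
    simp only [vecVar, hm, ← mul_div_assoc, Finset.mul_sum]
    congr 1
    refine Finset.sum_congr rfl fun i _ => ?_
    by_cases hi : i = 0
    · subst hi; simp; ring
    · simp [hi]; ring
  simp [lnFirst, layerNorm, hv, hm]
  ring

/-- From `c = 1` to `c = 2` the numerator doubles while the denominator strictly grows, and the
value at `0` is `0`. This failure of affinity lets an average of normalized tokens reveal which
position holds a token. -/
theorem lnFirst_two_ne {d : ℕ} [NeZero d] (hd : 2 ≤ d) {ε : ℝ} (hε : 0 < ε) :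
    lnFirst d ε 2 - lnFirst d ε 1 ≠ lnFirst d ε 1 - lnFirst d ε 0 := by
  have hd' : (2 : ℝ) ≤ d := by exact_mod_cast hd
  have hm : 0 < 1 - (d : ℝ)⁻¹ := by
    rw [sub_pos]
    exact inv_lt_one_of_one_lt₀ (by linarith)
  have hκ : 0 < vecVar (Pi.single (0 : Fin d) (1 : ℝ)) := by
    refine div_pos (Finset.sum_pos' (fun _ _ => sq_nonneg _) ⟨0, Finset.mem_univ _, ?_⟩)
      (by linarith)
    have : vecMean (Pi.single (0 : Fin d) (1 : ℝ)) = (d : ℝ)⁻¹ := by simp [vecMean]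
    rw [this, Pi.single_eq_same]
    positivity
  simp only [lnFirst_eq]
  set κ := vecVar (Pi.single (0 : Fin d) (1 : ℝ))
  set m := 1 - (d : ℝ)⁻¹
  have h1 : 0 < Real.sqrt (1 ^ 2 * κ + ε) := Real.sqrt_pos.2 (by positivity)
  have h2 : Real.sqrt (1 ^ 2 * κ + ε) < Real.sqrt (2 ^ 2 * κ + ε) :=
    Real.sqrt_lt_sqrt (by positivity) (by linarith)
  have h3 : 2 * m / Real.sqrt (2 ^ 2 * κ + ε) < 2 * m / Real.sqrt (1 ^ 2 * κ + ε) :=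
    div_lt_div_of_pos_left (by positivity) h1 h2
  have h4 : 2 * m / Real.sqrt (1 ^ 2 * κ + ε) = 2 * (1 * m / Real.sqrt (1 ^ 2 * κ + ε)) := by ring
  intro h
  rw [zero_mul, zero_div] at h
  linarith

/-- Parameters for which the first coordinate of the last-token representation sums a nonlinear
function of the tokens: the first block attends uniformly, and token `v` as well as position `i`
are embedded along the first basis vector. -/
noncomputable def uniformAttentionParams (A : TransformerArch) (v : V) (i : ℕ) (x : ℝ) :
    Params V A := by
  classical
  exact WithLp.toLp 2 fun a => match a with
    | .tok u c => if c.val = 0 then (if u = v then 1 else 0) else 0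
    | .pos k c => if c.val = 0 then (if k.val = i then x else 0) else 0
    | .block l j => if l.val = 0 then (match j with
        | .value h c j => if h.val = 0 ∧ c.val = 0 ∧ j.val = 0 then 1 else 0
        | .out h j c => if h.val = 0 ∧ c.val = 0 ∧ j.val = 0 then 1 else 0
        | .attnScale _ => 1
        | _ => 0) else 0
    | _ => 0

-- The first bracket is the residual stream. The second term comes from head `0` of the first block:
-- zero queries make its weights uniform, and a single channel copies coordinate `0` through value
-- and output. All later blocks are the identity.
open Classical in
theorem lastToken_uniformAttentionParams [NeZero A.width] (hdepth : 1 ≤ A.depth)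
    (hheads : ∀ l, 1 ≤ (A.block l).heads) (hattn : ∀ l, 1 ≤ (A.block l).attnDim)
    (v : V) (i : ℕ) (x : ℝ) (s : Prompt V A.contextLen) :
    lastToken A (uniformAttentionParams A v i x) s 0 =
      ((if s.2 (Fin.last _) = v then 1 else 0) + (if s.1.val = i then x else 0)) +
      ((s.1.val : ℝ) + 1)⁻¹ * ∑ b, lnFirst A.width A.lnEps
        ((if s.2 b = v then 1 else 0) + (if b.val = i then x else 0)) := by
  set θ := uniformAttentionParams A v i x with hθ
  set l₀ : Fin A.depth := ⟨0, hdepth⟩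
  set h₀ : Fin (A.block l₀).heads := ⟨0, hheads l₀⟩
  set j₀ : Fin (A.block l₀).attnDim := ⟨0, hattn l₀⟩
  have hid : ∀ (X : Matrix (Fin (s.1.val + 1)) (Fin A.width) ℝ) (l : Fin A.depth), l.val ≠ 0 →
      transformerBlock A.lnEps A.act (fun j => θ (.block l j)) X = X := fun X l hl =>
    transformerBlock_of_out_mlp_zero (fun _ _ _ => by simp [hθ, uniformAttentionParams, hl])
      (fun _ => by simp [hθ, uniformAttentionParams, hl]) X
  have hemb : ∀ b, embed A θ s b = Pi.single (0 : Fin A.width)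
      ((if s.2 b = v then (1 : ℝ) else 0) + (if b.val = i then x else 0)) := by
    intro b
    funext c
    by_cases hc : c = 0
    · subst hc
      simp [embed, hθ, uniformAttentionParams]
    · simp [embed, hθ, uniformAttentionParams, hc]
  rw [lastToken, hiddenStates, List.foldl_finRange_of_pos_eq_self hdepth hid,
    transformerBlock_of_mlp_zero (fun a => by simp [hθ, uniformAttentionParams])]
  rw [Matrix.add_apply]
  refine congrArg₂ (· + ·) (by rw [hemb, Pi.single_eq_same, Fin.val_last]) ?_
  set Y : Matrix (Fin (s.1.val + 1)) (Fin A.width) ℝ := Matrix.of fun t =>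
    layerNorm A.lnEps (fun i => θ (.block l₀ (.attnScale i)))
      (fun i => θ (.block l₀ (.attnShift i))) (embed A θ s t) with hY
  have hY0 : ∀ b, Y b 0 = lnFirst A.width A.lnEps
      ((if s.2 b = v then 1 else 0) + (if b.val = i then x else 0)) := by
    intro b
    rw [lnFirst, ← hemb b]
    simp [hY, hθ, uniformAttentionParams, layerNorm, l₀]
  have hval : ∀ b, (Y * Matrix.of fun c j => θ (.block l₀ (.value h₀ c j))) b j₀ = Y b 0 := by
    intro b
    rw [Matrix.mul_apply, Finset.sum_eq_single 0]
    · simp [hθ, uniformAttentionParams, l₀, h₀, j₀]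
    · intro c _ hc
      simp [hθ, uniformAttentionParams, hc]
    · simp
  have hhead : causalAttention (Matrix.of fun c j => θ (.block l₀ (.query h₀ c j)))
      (Matrix.of fun c j => θ (.block l₀ (.key h₀ c j)))
      (Matrix.of fun c j => θ (.block l₀ (.value h₀ c j))) Y (Fin.last _) j₀ =
      ((s.1.val : ℝ) + 1)⁻¹ * ∑ b, Y b 0 := by
    have hQ : (Matrix.of fun c j => θ (.block l₀ (.query h₀ c j))) = 0 := by
      ext c j; simp [hθ, uniformAttentionParams]
    rw [causalAttention, hQ, Matrix.mul_zero, Matrix.zero_mul, smul_zero, Matrix.mul_apply,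
      Finset.mul_sum]
    exact Finset.sum_congr rfl fun b _ => by rw [causalSoftmax_zero_last, hval]
  rw [multiHead, Matrix.sum_apply, Finset.sum_eq_single h₀]
  · rw [Matrix.mul_apply, Finset.sum_eq_single j₀]
    · refine Eq.trans (b := ((s.1.val : ℝ) + 1)⁻¹ * (∑ b, Y b 0) * 1) ?_ ?_
      · refine congrArg₂ _ hhead ?_
        simp [hθ, uniformAttentionParams, l₀, h₀, j₀]
      · simp only [hY0, mul_one]
    · intro j _ hj
      have hj' : j.val ≠ 0 := fun h => hj (Fin.ext (by simpa [j₀] using h))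
      simp [hθ, uniformAttentionParams, hj']
    · simp
  · intro h _ hh
    have hh' : h.val ≠ 0 := fun h' => hh (Fin.ext (by simpa [h₀] using h'))
    simp [hθ, uniformAttentionParams, hh', Matrix.mul_apply]
  · simp

/-- Distinct prompts have distinct last-token representations for some parameters. -/
theorem exists_lastToken_ne (hwidth : 2 ≤ A.width) (hdepth : 1 ≤ A.depth)
    (hheads : ∀ l, 1 ≤ (A.block l).heads) (hattn : ∀ l, 1 ≤ (A.block l).attnDim)
    (heps : 0 < A.lnEps) {s s' : Prompt V A.contextLen} (hs : s ≠ s') :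
    ∃ (θ : Params V A) (i : Fin A.width), lastToken A θ s i ≠ lastToken A θ s' i := by
  classical
  have : NeZero A.width := ⟨by omega⟩
  obtain ⟨k, s⟩ := s
  obtain ⟨k', s'⟩ := s'
  by_cases hk : k = k'
  swap
  -- With zero blocks only the embedding of the last position survives; here it records the length.
  · refine ⟨WithLp.toLp 2 fun a => match a with
      | .pos k _ => (k.val : ℝ)
      | _ => 0, 0, ?_⟩
    rw [lastToken_of_block_zero (fun _ _ => rfl), lastToken_of_block_zero (fun _ _ => rfl)]
    simpa [Fin.val_inj] using hk
  subst hk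
  by_cases hlast : s (Fin.last _) = s' (Fin.last _)
  swap
  -- Equal lengths but distinct last tokens: an indicator token embedding separates them.
  · refine ⟨WithLp.toLp 2 fun a => match a with
      | .tok u _ => if u = s (Fin.last _) then (1 : ℝ) else 0
      | _ => 0, 0, ?_⟩
    rw [lastToken_of_block_zero (fun _ _ => rfl), lastToken_of_block_zero (fun _ _ => rfl)]
    simp [Ne.symm hlast]
  obtain ⟨i, hi⟩ : ∃ i, s i ≠ s' i := by
    by_contra! h
    exact hs (congrArg _ (funext h))
  by_contra! hall
  have hsum : ∀ x : ℝ,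
      ∑ b, lnFirst A.width A.lnEps ((if s b = s i then 1 else 0) + (if b.val = i.val then x else 0))
        = ∑ b, lnFirst A.width A.lnEps
          ((if s' b = s i then 1 else 0) + (if b.val = i.val then x else 0)) := by
    intro x
    have h := hall (uniformAttentionParams A (s i) i.val x) 0
    rw [lastToken_uniformAttentionParams hdepth hheads hattn,
      lastToken_uniformAttentionParams hdepth hheads hattn] at h
    simp only [hlast, add_right_inj] at h
    exact mul_left_cancel₀ (by positivity) h
  -- Switching the positional signal `x` from `0` to `1` changes only the summand at `i`. The odd
  -- `then 0 else 0` is the instance `hsum 0`, kept verbatim for rewriting.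
  have hdiff : ∀ t : Fin (k.val + 1) → V,
      ∑ b, lnFirst A.width A.lnEps ((if t b = s i then 1 else 0) + (if b.val = i.val then 1 else 0))
      - ∑ b, lnFirst A.width A.lnEps
        ((if t b = s i then 1 else 0) + (if b.val = i.val then 0 else 0)) =
      lnFirst A.width A.lnEps ((if t i = s i then 1 else 0) + 1) -
        lnFirst A.width A.lnEps (if t i = s i then 1 else 0) := by
    intro t
    rw [← Finset.sum_sub_distrib, Finset.sum_eq_single i]
    · simp
    · intro b _ hb
      have hb' : b.val ≠ i.val := fun h => hb (Fin.ext h)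
      simp [hb']
    · simp
  have h1 := hdiff s
  rw [hsum 1, hsum 0, hdiff s'] at h1
  simp only [Ne.symm hi, if_true, if_false, zero_add] at h1
  refine lnFirst_two_ne hwidth heps ?_
  norm_num at h1
  exact h1.symm

end Witness

/-! ### Second-order behaviour of the loss along rays from the origin -/

section LossAlongRays

open Set Topology Filter

/-- The cross-entropy of the softmax of logits that vanish to second order at `0`. -/
theorem hasDerivAt_crossEntropy_sq_mul {V : Type*} [Fintype V] [Nonempty V] (q : V → ℝ)
    {ω : V → ℝ → ℝ}
    (hω : ∀ u, AnalyticOnNhd ℝ (ω u) univ) :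
    ∃ k : ℝ → ℝ, ContinuousAt k 0 ∧
      (∀ t, HasDerivAt (fun t : ℝ => Real.log (∑ u, Real.exp (t ^ 2 * ω u t)) -
        ∑ u, q u * (t ^ 2 * ω u t)) (t * k t) t) ∧
      k 0 = ∑ u, ((Fintype.card V : ℝ)⁻¹ - q u) * (2 * ω u 0) := by
  have hd : ∀ u t, DifferentiableAt ℝ (ω u) t := fun u t => (hω u t (mem_univ t)).differentiableAt
  have hc : ∀ u, Continuous (ω u) := fun u => Differentiable.continuous (hd u)
  have hc' : ∀ u, Continuous (deriv (ω u)) := fun u =>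
    Differentiable.continuous fun t => ((hω u).deriv t (mem_univ t)).differentiableAt
  -- The derivative of `t ^ 2 * ω u t` is `t * (2 * ω u t + t * deriv (ω u) t)`; `k` collects what
  -- remains after removing the factor `t`. At `0` the softmax weights are uniform.
  refine ⟨fun t => (∑ u, Real.exp (t ^ 2 * ω u t) * (2 * ω u t + t * deriv (ω u) t)) /
    (∑ u, Real.exp (t ^ 2 * ω u t)) - ∑ u, q u * (2 * ω u t + t * deriv (ω u) t), ?_, ?_, ?_⟩
  · refine Continuous.continuousAt (Continuous.sub (Continuous.div ?_ ?_ ?_) ?_)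
    · fun_prop
    · fun_prop
    · exact fun t => (exp_sum_pos _).ne'
    · fun_prop
  · intro t
    have ha : ∀ u, HasDerivAt (fun t => t ^ 2 * ω u t) (t * (2 * ω u t + t * deriv (ω u) t)) t := by
      intro u
      have h := ((hasDerivAt_pow 2 t).mul (hd u t).hasDerivAt)
      refine h.congr_deriv ?_
      simp
      ring
    have h1 : HasDerivAt (fun t => ∑ u, Real.exp (t ^ 2 * ω u t))
        (∑ u, Real.exp (t ^ 2 * ω u t) * (t * (2 * ω u t + t * deriv (ω u) t))) t :=
      HasDerivAt.fun_sum fun u _ => (ha u).exp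
    have h2 : HasDerivAt (fun t => ∑ u, q u * (t ^ 2 * ω u t))
        (∑ u, q u * (t * (2 * ω u t + t * deriv (ω u) t))) t :=
      HasDerivAt.fun_sum fun u _ => (ha u).const_mul (q u)
    refine ((h1.log (exp_sum_pos _).ne').sub h2).congr_deriv ?_
    rw [mul_sub, ← mul_div_assoc, Finset.mul_sum, Finset.mul_sum]
    congr 1
    · congr 1
      exact Finset.sum_congr rfl fun u _ => by ring
    · exact Finset.sum_congr rfl fun u _ => by ring
  · simp only [sub_mul, Finset.sum_sub_distrib, ← Finset.mul_sum]
    simp [div_eq_inv_mul, Finset.mul_sum]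

/-- The sum equals `∑ q u ^ 2 - 1 / |V|`, and `q u ^ 2 ≤ q u`. -/
theorem sum_sq_inv_card_sub_le_one {V : Type*} [Fintype V] [Nonempty V] {q : V → ℝ}
    (hq₀ : ∀ u, 0 ≤ q u) (hq₁ : ∑ u, q u = 1) :
    ∑ u, ((Fintype.card V : ℝ)⁻¹ - q u) ^ 2 ≤ 1 := by
  set n : ℝ := (Fintype.card V : ℝ)
  have hn : 0 < n := by simpa [n] using Fintype.card_pos
  have h1 : ∑ u, q u ^ 2 ≤ 1 := by
    rw [← hq₁]
    refine Finset.sum_le_sum fun u _ => ?_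
    have hle : q u ≤ 1 := hq₁ ▸ Finset.single_le_sum (fun v _ => hq₀ v) (Finset.mem_univ u)
    nlinarith [hq₀ u]
  have h2 : ∑ u, (n⁻¹ - q u) ^ 2 = ∑ u, q u ^ 2 - n⁻¹ := by
    have : ∀ u, (n⁻¹ - q u) ^ 2 = q u ^ 2 - 2 * n⁻¹ * q u + n⁻¹ ^ 2 := fun u => by ring
    simp only [this, Finset.sum_add_distrib, Finset.sum_sub_distrib, ← Finset.mul_sum, hq₁,
      Finset.sum_const, Finset.card_univ, nsmul_eq_mul]
    change _ - _ + n * _ = _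
    field_simp
    ring
  rw [h2]
  linarith [inv_pos.2 hn]

/-- Entrywise `2 g U β ≤ U ^ 2 + g ^ 2 β ^ 2`. The resulting constant `1` is what makes every step
size below `1` admissible. -/
theorem sum_mul_sum_mul_le {V ι : Type*} [Fintype V] [Fintype ι] {g : V → ℝ}
    (hg : ∑ u, g u ^ 2 ≤ 1) (U : V → ι → ℝ) (β : ι → ℝ) :
    ∑ u, g u * (2 * ∑ i, U u i * β i) ≤ (∑ u, ∑ i, U u i ^ 2) + ∑ i, β i ^ 2 := by
  have h1 : ∑ u, g u * (2 * ∑ i, U u i * β i) ≤ ∑ u, ∑ i, (U u i ^ 2 + g u ^ 2 * β i ^ 2) := by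
    refine Finset.sum_le_sum fun u _ => ?_
    rw [Finset.mul_sum, Finset.mul_sum]
    refine Finset.sum_le_sum fun i _ => ?_
    nlinarith [sq_nonneg (U u i - g u * β i)]
  have h2 : ∑ u, ∑ i, (U u i ^ 2 + g u ^ 2 * β i ^ 2) =
      (∑ u, ∑ i, U u i ^ 2) + (∑ u, g u ^ 2) * ∑ i, β i ^ 2 := by
    simp only [Finset.sum_add_distrib, Finset.sum_mul_sum]
  have h3 : 0 ≤ ∑ i, β i ^ 2 := Finset.sum_nonneg fun _ _ => sq_nonneg _
  nlinarith

variable {V : Type*} [Fintype V] {A : TransformerArch}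

/-- The two families are disjoint sets of coordinates of `v`. -/
theorem unembed_sq_add_finalShift_sq_le (v : Params V A) :
    (∑ u, ∑ i, v (.unembed u i) ^ 2) + ∑ i, v (.finalShift i) ^ 2 ≤ ‖v‖ ^ 2 := by
  let f : (V × Fin A.width) ⊕ Fin A.width ↪ ParamIdx V A :=
    ⟨Sum.elim (fun p => .unembed p.1 p.2) fun i => .finalShift i, by
      rintro (⟨a, b⟩ | a) (⟨c, d⟩ | c) h <;> simp_all⟩
  have h : ∑ x, v (f x) ^ 2 ≤ ∑ a, v a ^ 2 := by
    rw [← Finset.sum_map Finset.univ f fun a => v a ^ 2]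
    exact Finset.sum_le_univ_sum_of_nonneg fun _ => sq_nonneg _
  rw [EuclideanSpace.real_norm_sq_eq]
  rw [Fintype.sum_sum_type, Fintype.sum_prod_type] at h
  exact h

theorem layerNorm_one_zero {d : ℕ} (ε : ℝ) (γ β x : Fin d → ℝ) (i : Fin d) :
    layerNorm ε γ β x i = γ i * layerNorm ε 1 0 x i + β i := by
  simp [layerNorm]

theorem layerNorm_of_input_zero {d : ℕ} (ε : ℝ) (γ β : Fin d → ℝ) : layerNorm ε γ β 0 = β := by
  funext i
  simp [layerNorm, vecMean]

theorem lastToken_zero (s : Prompt V A.contextLen) : lastToken A (0 : Params V A) s = 0 := by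
  funext i
  rw [lastToken_of_block_zero (fun _ _ => rfl)]
  simp

/-- The second derivative of the loss of a sample at zero along any direction is at most the
squared norm. -/
theorem sampleLoss_along_ray (heps : 0 < A.lnEps) (hact : AnalyticOnNhd ℝ A.act univ)
    (z : Sample V A.contextLen) (v : Params V A) :
    ∃ k : ℝ → ℝ, ContinuousAt k 0 ∧
      (∀ t, HasDerivAt (fun t : ℝ => sampleLoss A z (t • v)) (t * k t) t) ∧
      k 0 ≤ ‖v‖ ^ 2 := by
  have := Prompt.nonempty_vocab z.1
  -- One factor `t` is pulled from the unembedding and one from the final scale and shift; the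
  -- representation keeps its full dependence on `t`. At `t = 0` it vanishes, leaving only the shift
  -- term.
  set ω : V → ℝ → ℝ := fun u t => ∑ i, v (.unembed u i) * (v (.finalScale i) *
    layerNorm A.lnEps 1 0 (lastToken A (t • v) z.1) i + v (.finalShift i)) with hωdef
  have hω : ∀ u, AnalyticOnNhd ℝ (ω u) univ := by
    intro u t _
    have hr : ∀ i, AnalyticAt ℝ (fun t : ℝ => lastToken A (t • v) z.1 i) t := fun i =>
      (analyticAt_lastToken heps hact z.1 i (t • v)).fun_comp
        (f := fun t : ℝ => t • v) (by fun_prop)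
    exact Finset.analyticAt_fun_sum _ fun i _ => analyticAt_const.mul
      ((analyticAt_const.mul (analyticAt_layerNorm heps (fun _ => analyticAt_const)
        (fun _ => analyticAt_const) hr i)).add analyticAt_const)
  have hlogits : ∀ u t, logits A (t • v) z.1 u = t ^ 2 * ω u t := by
    intro u t
    rw [logits, hωdef, Finset.mul_sum]
    refine Finset.sum_congr rfl fun i _ => ?_
    rw [layerNorm_one_zero]
    simp only [PiLp.smul_apply, smul_eq_mul]
    ring
  obtain ⟨k, hk, hderiv, hk0⟩ := hasDerivAt_crossEntropy_sq_mul z.2 hω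
  refine ⟨k, hk, fun t => ?_, ?_⟩
  · simp only [sampleLoss_eq, hlogits]
    exact hderiv t
  · have hω0 : ∀ u, ω u 0 = ∑ i, v (.unembed u i) * v (.finalShift i) := by
      intro u
      simp [hωdef, lastToken_zero, layerNorm_of_input_zero]
    rw [hk0]
    simp only [hω0]
    exact (sum_mul_sum_mul_le (sum_sq_inv_card_sub_le_one z.2.2.1 z.2.2.2) _ _).trans
      (unembed_sq_add_finalShift_sq_le v)

theorem batchLoss_along_ray (heps : 0 < A.lnEps) (hact : AnalyticOnNhd ℝ A.act univ)
    (B : Multiset (Sample V A.contextLen)) (v : Params V A) :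
    ∃ k : ℝ → ℝ, ContinuousAt k 0 ∧
      (∀ t, HasDerivAt (fun t : ℝ => batchLoss A B (t • v)) (t * k t) t) ∧
      k 0 ≤ ‖v‖ ^ 2 := by
  have hsum : ∃ k : ℝ → ℝ, ContinuousAt k 0 ∧
      (∀ t, HasDerivAt (fun t : ℝ => (B.map fun z => sampleLoss A z (t • v)).sum) (t * k t) t) ∧
      k 0 ≤ ‖v‖ ^ 2 * B.card := by
    induction B using Multiset.induction_on with
    | empty =>
      refine ⟨0, continuousAt_const, fun t => ?_, by simp⟩
      simpa using hasDerivAt_const t (0 : ℝ)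
    | cons z B ih =>
      obtain ⟨k₁, hc₁, hd₁, hb₁⟩ := sampleLoss_along_ray heps hact z v
      obtain ⟨k₂, hc₂, hd₂, hb₂⟩ := ih
      refine ⟨fun t => k₁ t + k₂ t, hc₁.add hc₂, fun t => ?_, ?_⟩
      · simpa [mul_add] using (hd₁ t).fun_add (hd₂ t)
      · rw [Multiset.card_cons]
        push_cast
        linarith
  obtain ⟨k, hc, hd, hb⟩ := hsum
  refine ⟨fun t => k t / B.card, hc.div_const _, fun t => ?_, ?_⟩
  · rw [← mul_div_assoc]
    exact (hd t).div_const _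
  -- This also covers the empty batch, where division by zero gives `0`.
  · exact div_le_of_le_mul₀ (Nat.cast_nonneg _) (sq_nonneg _) hb

end LossAlongRays

/-! ### Almost sure injectivity along the trajectory -/

section MainResult

variable {V : Type*} [Fintype V] {A : TransformerArch}

theorem volume_preimage_gradientStep_eq_zero (heps : 0 < A.lnEps)
    (hact : AnalyticOnNhd ℝ A.act Set.univ) {η : ℝ} (hη : η ∈ Set.Ioo (0 : ℝ) 1)
    (B : Multiset (Sample V A.contextLen)) {N : Set (Params V A)} (hN : volume N = 0) :
    volume ((fun θ => θ - η • gradient (batchLoss A B) θ) ⁻¹' N) = 0 := by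
  have hL : AnalyticOnNhd ℝ (batchLoss A B) Set.univ := fun θ _ =>
    analyticAt_batchLoss heps hact B θ
  have hφ : AnalyticOnNhd ℝ (fun θ => θ - η • gradient (batchLoss A B) θ) Set.univ := fun θ hθ =>
    analyticAt_id.fun_sub (analyticAt_const.fun_smul (analyticOnNhd_gradient hL θ hθ))
  exact addHaar_preimage_eq_zero_of_analytic volume hφ
    (fderiv_gradientStep_injective hL hη.1 hη.2 (batchLoss_along_ray heps hact B)) hN

theorem volume_lastToken_eq_eq_zero (hwidth : 2 ≤ A.width) (hdepth : 1 ≤ A.depth)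
    (hheads : ∀ l, 1 ≤ (A.block l).heads) (hattn : ∀ l, 1 ≤ (A.block l).attnDim)
    (heps : 0 < A.lnEps) (hact : AnalyticOnNhd ℝ A.act Set.univ)
    {s s' : Prompt V A.contextLen} (hs : s ≠ s') :
    volume {θ : Params V A | lastToken A θ s = lastToken A θ s'} = 0 := by
  obtain ⟨θ₀, i, hi⟩ := exists_lastToken_ne hwidth hdepth hheads hattn heps hs
  refine measure_mono_null (fun θ hθ => ?_) (addHaar_zeros_eq_zero_of_analytic volume
    (f := fun θ : Params V A => lastToken A θ s i - lastToken A θ s' i)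
    (fun θ _ => (analyticAt_lastToken heps hact s i θ).sub (analyticAt_lastToken heps hact s' i θ))
    (sub_ne_zero.2 hi))
  exact sub_eq_zero.2 (congrFun hθ i)

end MainResult

theorem mainTheorem7 {V : Type*} [Fintype V] (A : TransformerArch)
    (hwidth : 4 ≤ A.width) (hdepth : 1 ≤ A.depth)
    (hheads : ∀ l, 1 ≤ (A.block l).heads) (hattn : ∀ l, 1 ≤ (A.block l).attnDim)
    (heps : 0 < A.lnEps) (hact : AnalyticOnNhd ℝ A.act Set.univ)
    -- the training data
    (D : Set (Sample V A.contextLen)) (hD : D.Countable)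
    -- the horizon and the step sizes
    (T : ℕ) (η : ℕ → ℝ) (hη : ∀ t < T, η t ∈ Set.Ioo (0 : ℝ) 1)
    {Ω : Type*} [MeasurableSpace Ω] (P : Measure Ω) [IsProbabilityMeasure P]
    -- the batches: arbitrary functions of the outcome
    (B : ℕ → Ω → Multiset (Sample V A.contextLen))
    (hB : ∀ t < T, ∀ ω, B t ω ≠ 0 ∧ ∀ z ∈ B t ω, z ∈ D)
    -- the parameters
    (θ : ℕ → Ω → Params V A)
    (hmeas : AEMeasurable (θ 0) P) (hac : P.map (θ 0) ≪ volume)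
    (hstep : ∀ t < T, ∀ ω,
      θ (t + 1) ω = θ t ω - η t • gradient (batchLoss A (B t ω)) (θ t ω)) :
    ∀ᵐ ω ∂P, ∀ s s' : Prompt V A.contextLen,
      s ≠ s' → lastToken A (θ T ω) s ≠ lastToken A (θ T ω) s' := by
  -- Avoiding every null set is the inductive form of absolute continuity; it needs no measurability
  -- of the batches or of later iterates.
  have key : ∀ t ≤ T, ∀ N : Set (Params V A), volume N = 0 → ∀ᵐ ω ∂P, θ t ω ∉ N := by
    intro t
    induction t with
    | zero =>
      intro _ N hN
      exact ae_of_ae_map hmeas (measure_eq_zero_iff_ae_notMem.1 (hac hN))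
    | succ t ih =>
      intro ht N hN
      have : Countable D := hD.to_subtype
      -- Finite multisets over a countable set are countable, so one null set handles every possible
      -- batch at once.
      have hnull : volume (⋃ C : Multiset D, (fun x => x - η t •
          gradient (batchLoss A (C.map Subtype.val)) x) ⁻¹' N) = 0 :=
        measure_iUnion_null fun C =>
          volume_preimage_gradientStep_eq_zero heps hact (hη t ht) _ hN
      filter_upwards [ih (Nat.le_of_succ_le ht) _ hnull] with ω hω hmem
      rw [hstep t ht ω] at hmem
      refine hω (Set.mem_iUnion.2 ⟨(B t ω).attach.map fun z => ⟨z.1, (hB t ht ω).2 z.1 z.2⟩, ?_⟩)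
      simpa [Multiset.map_map] using hmem
  refine ae_all_iff.2 fun s => ae_all_iff.2 fun s' => ?_
  by_cases hs : s = s'
  · exact Filter.Eventually.of_forall fun _ h => absurd hs h
  · filter_upwards [key T le_rfl _ (volume_lastToken_eq_eq_zero (by omega) hdepth hheads hattn
      heps hact hs)] with ω hω _
    exact hω
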